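/- Let $H:\mathbb{R}\to M_N(\mathbb{C})$ be a time-dependent Hamiltonian of period $T>0$: every $H(t)$ is Hermitian, $H(t+T)=H(t)$ for all $t$, and the entries of $H$ are locally integrable functions of $t$. Let $\Gamma\in M_N(\mathbb{C})$ be unitary with $\Gamma^2=I$ and with eigenspaces for $+1$ and $-1$ of the same dimension, and suppose that $H$ has the chiral symmetry $\Gamma H(t)\Gamma=-H(-t)$ for all $t\in\mathbb{R}$. Then there is a unique time-evolution operator generated by $H$, that is, a unique family $U(s,t)$, $s,t\in\mathbb{R}$, of matrices that is continuous in $t$ for each $s$ and satisfies $$U(s,t)=I-i\int_s^t H(\tau)\,U(s,\tau)\,d\tau\qquad(s,t\in\mathbb{R}).$$ For an invertible Hermitian matrix $X$ let $\operatorname{sig}(X)$ be the number of positive eigenvalues of $X$ minus the number of negative eigenvalues of $X$, counted with multiplicity, and write $U(T)=U(0,T)$. Then $U(T)\Gamma$ is Hermitian and invertible, and $$\tfrac12\operatorname{sig}(U(T)\Gamma)=0.$$ Moreover, $t\mapsto U(t,T-t)$, $0\le t\le T/2$, is a continuous path of unitary matrices with $\Gamma U(t,T-t)\Gamma=U(t,T-t)^\dagger$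 which ends at $U(T/2,T/2)=I$, and for every $t\in[0,T/2]$ the matrix $U(t,T-t)\Gamma$ is Hermitian and invertible with $\tfrac12\operatorname{sig}(U(t,T-t)\Gamma)=0$. -/

import Mathlib

open MeasureTheory

namespace Floquet

/-- `H` is a time-dependent Hamiltonian of period `T > 0`: each `H t` is a Hermitian matrix,
`H (t + T) = H t`, and the entries of `H` are locally integrable functions of time
(continuous and piecewise continuous drives are special cases). -/
structure IsPeriodicHamiltonian {n : Type*} (H : ℝ → Matrix n n ℂ) (T : ℝ) : Prop where
  period_pos : 0 < T
  periodic : Function.Periodic H T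
  isHermitian : ∀ t, (H t).IsHermitian
  locallyIntegrable : ∀ i j, LocallyIntegrable (fun t => H t i j) volume

/-- `U s t` is the time-evolution operator from time `s` to time `t` generated by `H`: for each
`s`, the map `t ↦ U s t` is the (continuous) solution of the Schrödinger equation
`i ∂U/∂t = H(t) U`, `U(s, s) = 1`, written in integrated form
`U(s, t) = 1 - i ∫_s^t H(τ) U(s, τ) dτ`, with the integral taken entrywise. -/
structure IsTimeEvolution {n : Type*} [Fintype n] [DecidableEq n]
    (H : ℝ → Matrix n n ℂ) (U : ℝ → ℝ → Matrix n n ℂ) : Prop where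
  continuous : ∀ s, Continuous (U s)
  schrodinger : ∀ s t i j,
    U s t i j = (1 : Matrix n n ℂ) i j - Complex.I * ∫ τ in s..t, (H τ * U s τ) i j

/-- The signature of a Hermitian matrix: the number of positive eigenvalues minus the number of
negative eigenvalues, counted with multiplicity. -/
noncomputable def sig {n : Type*} [Fintype n] [DecidableEq n]
    {X : Matrix n n ℂ} (hX : X.IsHermitian) : ℤ :=
  ((Finset.univ.filter fun i => 0 < hX.eigenvalues i).card : ℤ)
    - ((Finset.univ.filter fun i => hX.eigenvalues i < 0).card : ℤ)

/-- `Γ` is a unitary matrix with `Γ ^ 2 = 1` that is balanced: its eigenspaces for `1` and `-1`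
have the same dimension. -/
structure IsBalancedGrading {n : Type*} [Fintype n] [DecidableEq n]
    (Γ : Matrix n n ℂ) : Prop where
  unitary : Γ ∈ Matrix.unitaryGroup n ℂ
  sq_eq_one : Γ * Γ = 1
  balanced : Module.finrank ℂ (Module.End.eigenspace (Matrix.toLin' Γ) 1) =
    Module.finrank ℂ (Module.End.eigenspace (Matrix.toLin' Γ) (-1))

end Floquet

/-! Put A = -iH. Chirality gives ΓA(t)Γ = -A(-t), so ΓU(-s,-t)Γ solves the same equation as U(s,t),
and uniqueness identifies them (`IsPropagator.conj_neg`). With periodicity, ΓU(t,T/2)Γ = U(T-t,T/2).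
Splitting the evolution at T/2 then gives U(t,T-t) = ΓU(t,T/2)†ΓU(t,T/2)
(`IsPropagator.eq_chiral_factorization`). Hence U(t,T-t)Γ = B†ΓB with the unitary B = U(t,T/2)Γ.
This is a Hermitian involution, whose signature is its trace (`sig_eq_trace`), namely tr Γ = 0. The
signature is thus computed for each t directly, with no homotopy argument.

The analytic work lies in the coefficients being only locally integrable: solutions come from the
Dyson series, and unitarity from a product rule for absolutely continuous functions. -/

namespace Floquet

open Set intervalIntegral

/-! ### Calculus of primitives of locally integrable functions. -/

section Primitives

theorem intervalIntegrable_of_locallyIntegrable {E : Type*} [NormedAddCommGroup E] {f : ℝ → E}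
    (hf : LocallyIntegrable f volume) (a b : ℝ) : IntervalIntegrable f volume a b :=
  intervalIntegrable_iff.mpr <|
    (hf.integrableOn_isCompact isCompact_uIcc).mono_set uIoc_subset_uIcc

theorem locallyIntegrable_norm {E : Type*} [NormedAddCommGroup E] {f : ℝ → E}
    (hf : LocallyIntegrable f volume) : LocallyIntegrable (fun τ => ‖f τ‖) volume :=
  fun x => (hf x).norm

theorem continuous_primitive_of_locallyIntegrable {E : Type*} [NormedAddCommGroup E]
    [NormedSpace ℝ E] {f : ℝ → E} (hf : LocallyIntegrable f volume) (s : ℝ) :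
    Continuous fun t => ∫ τ in s..t, f τ :=
  continuous_primitive (fun a b => intervalIntegrable_of_locallyIntegrable hf a b) s

theorem locallyIntegrable_mul_continuous {R : Type*} [NormedRing R] {f g : ℝ → R}
    (hf : LocallyIntegrable f volume) (hg : Continuous g) :
    LocallyIntegrable (fun τ => f τ * g τ) volume := by
  rw [← locallyIntegrableOn_univ] at hf ⊢
  exact hf.mul_continuousOn hg.continuousOn isOpen_univ.isLocallyClosed

theorem locallyIntegrable_continuous_mul {R : Type*} [NormedRing R] {f g : ℝ → R}
    (hf : Continuous f) (hg : LocallyIntegrable g volume) :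
    LocallyIntegrable (fun τ => f τ * g τ) volume := by
  rw [← locallyIntegrableOn_univ] at hg ⊢
  exact hg.continuousOn_mul hf.continuousOn isOpen_univ.isLocallyClosed

/-- Increments are dominated by those of the primitive of `‖f‖`, which reduces to the real-valued
case. -/
theorem absolutelyContinuousOnInterval_integral
    {E : Type*} [NormedAddCommGroup E] [NormedSpace ℝ E] {f : ℝ → E}
    (hf : LocallyIntegrable f volume) (c a b : ℝ) :
    AbsolutelyContinuousOnInterval (fun x => ∫ τ in c..x, f τ) a b := by
  have hi := intervalIntegrable_of_locallyIntegrable hf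
  have h := (hi a b).norm.absolutelyContinuousOnInterval_intervalIntegral (c := a) (by simp)
  rw [absolutelyContinuousOnInterval_iff] at h ⊢
  intro ε hε
  obtain ⟨δ, hδ, H⟩ := h ε hε
  refine ⟨δ, hδ, fun E hE hlt => lt_of_le_of_lt (Finset.sum_le_sum fun i _ => ?_) (H E hE hlt)⟩
  rw [dist_eq_norm, dist_eq_norm, integral_interval_sub_left (hi _ _) (hi _ _),
    integral_interval_sub_left (hi _ _).norm (hi _ _).norm, Real.norm_eq_abs]
  exact norm_integral_le_abs_integral_norm

/-- Product rule, in integrated form, for primitives of locally integrable functions. -/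
theorem mul_eq_add_integral_of_primitive {𝕜 : Type*} [RCLike 𝕜] {f g F G : ℝ → 𝕜} {s : ℝ}
    (hf : LocallyIntegrable f volume) (hg : LocallyIntegrable g volume)
    (hF : ∀ t, F t = F s + ∫ τ in s..t, f τ) (hG : ∀ t, G t = G s + ∫ τ in s..t, g τ) (t : ℝ) :
    F t * G t = F s * G s + ∫ τ in s..t, (f τ * G τ + F τ * g τ) := by
  have cF : Continuous F := by
    rw [funext hF]
    exact continuous_const.add (continuous_primitive_of_locallyIntegrable hf s)
  have cG : Continuous G := by
    rw [funext hG]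
    exact continuous_const.add (continuous_primitive_of_locallyIntegrable hg s)
  have hd : LocallyIntegrable (fun τ => f τ * G τ + F τ * g τ) volume :=
    (locallyIntegrable_mul_continuous hf cG).add (locallyIntegrable_continuous_mul cF hg)
  have acF : AbsolutelyContinuousOnInterval F s t := by
    rw [funext hF]
    exact ((LipschitzWith.const (F s)).lipschitzOnWith).absolutelyContinuousOnInterval.add
      (absolutelyContinuousOnInterval_integral hf s s t)
  have acG : AbsolutelyContinuousOnInterval G s t := by
    rw [funext hG]
    exact ((LipschitzWith.const (G s)).lipschitzOnWith).absolutelyContinuousOnInterval.add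
      (absolutelyContinuousOnInterval_integral hg s s t)
  -- The difference of the two sides is absolutely continuous with zero derivative almost everywhere
  -- (Lebesgue differentiation), hence constant.
  have ac : AbsolutelyContinuousOnInterval
      (fun x => F x * G x - ∫ τ in s..x, (f τ * G τ + F τ * g τ)) s t :=
    (acF.smul acG).sub (absolutelyContinuousOnInterval_integral hd s s t)
  obtain ⟨C, hC⟩ := ac.const_of_ae_hasDerivAt_zero (by
    filter_upwards [_root_.LocallyIntegrable.ae_hasDerivAt_integral hf,
      _root_.LocallyIntegrable.ae_hasDerivAt_integral hg,
      _root_.LocallyIntegrable.ae_hasDerivAt_integral hd] with x h₁ h₂ h₃ _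
    have e₁ : HasDerivAt F (f x) x := by rw [funext hF]; exact (h₁ s).const_add _
    have e₂ : HasDerivAt G (g x) x := by rw [funext hG]; exact (h₂ s).const_add _
    have := (e₁.mul e₂).sub (h₃ s)
    rwa [sub_self] at this)
  have h₁ := hC s (by simp)
  have h₂ := hC t (by simp)
  rw [integral_same, sub_zero] at h₁
  rw [h₁, ← h₂, sub_add_cancel]

/-- The primitive need not be differentiable everywhere, so induction with the integrated product
rule replaces the chain rule. -/
theorem integral_mul_pow_primitive {k : ℝ → ℝ} (hk : LocallyIntegrable k volume) (s t : ℝ)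
    (m : ℕ) :
    ∫ τ in s..t, k τ * (∫ σ in s..τ, k σ) ^ m = (∫ τ in s..t, k τ) ^ (m + 1) / (m + 1) := by
  have ch := continuous_primitive_of_locallyIntegrable hk s
  have hki : ∀ m : ℕ, LocallyIntegrable (fun τ => k τ * (∫ σ in s..τ, k σ) ^ m) volume :=
    fun m => locallyIntegrable_mul_continuous hk (ch.pow m)
  induction m generalizing t with
  | zero => simp
  | succ m ih =>
    have h := mul_eq_add_integral_of_primitive (s := s) hk (hki m)
      (F := fun t => ∫ σ in s..t, k σ) (G := fun t => (∫ σ in s..t, k σ) ^ (m + 1) / (m + 1))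
      (by simp) (by simp [ih]) t
    simp only [integral_same, zero_mul, zero_add] at h
    have e : (fun τ => k τ * ((∫ σ in s..τ, k σ) ^ (m + 1) / (m + 1)) +
        (∫ σ in s..τ, k σ) * (k τ * (∫ σ in s..τ, k σ) ^ m)) =
        fun τ => ((m + 2 : ℝ) / (m + 1)) * (k τ * (∫ σ in s..τ, k σ) ^ (m + 1)) := by
      ext τ
      field_simp
      ring
    rw [e, intervalIntegral.integral_const_mul] at h
    have : (m + 2 : ℝ) ≠ 0 := by positivity
    push_cast
    field_simp at h ⊢
    linear_combination -h

theorem abs_integral_mul_abs_pow {k : ℝ → ℝ} (hk : LocallyIntegrable k volume) (h0 : ∀ τ, 0 ≤ k τ)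
    (s t : ℝ) (m : ℕ) :
    |∫ τ in s..t, k τ * |∫ σ in s..τ, k σ| ^ m| = |∫ τ in s..t, k τ| ^ (m + 1) / (m + 1) := by
  have e : |∫ τ in s..t, k τ * |∫ σ in s..τ, k σ| ^ m| =
      |∫ τ in s..t, k τ * (∫ σ in s..τ, k σ) ^ m| := by
    rcases le_total s t with hst | hst
    · congr 1
      refine integral_congr fun τ hτ => ?_
      rw [uIcc_of_le hst] at hτ
      simp only [abs_of_nonneg (integral_nonneg hτ.1 fun σ _ => h0 σ)]
    -- Backwards in time the primitive is nonpositive, so a constant sign factors out.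
    · have : ∫ τ in s..t, k τ * |∫ σ in s..τ, k σ| ^ m =
          ∫ τ in s..t, (-1) ^ m * (k τ * (∫ σ in s..τ, k σ) ^ m) := by
        refine integral_congr fun τ hτ => ?_
        rw [uIcc_of_ge hst] at hτ
        have : ∫ σ in s..τ, k σ ≤ 0 := by
          rw [integral_symm]
          exact neg_nonpos.2 (integral_nonneg hτ.2 fun σ _ => h0 σ)
        simp only [abs_of_nonpos this, neg_pow (∫ σ in s..τ, k σ)]
        ring
      rw [this, intervalIntegral.integral_const_mul, abs_mul, abs_pow, abs_neg, abs_one, one_pow,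
        one_mul]
  rw [e, integral_mul_pow_primitive hk, abs_div, abs_pow,
    abs_of_nonneg (by positivity : (0 : ℝ) ≤ m + 1)]

end Primitives

/-! ### Linear Volterra equations in a Banach algebra. -/

section Volterra

variable {𝔸 : Type*} [NormedRing 𝔸] [NormedAlgebra ℝ 𝔸] {A : ℝ → 𝔸}

/-- One Picard step: it advances a bound by a term of the exponential series to the next term. Both
uniqueness and convergence iterate it. -/
theorem norm_integral_mul_le (hA : LocallyIntegrable A volume) {y : ℝ → 𝔸} {s t C : ℝ} {m : ℕ}
    (hC : 0 ≤ C)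
    (hy : ∀ τ ∈ uIcc s t, ‖y τ‖ ≤ C * (|∫ σ in s..τ, ‖A σ‖| ^ m / m.factorial)) :
    ‖∫ τ in s..t, A τ * y τ‖ ≤
      C * (|∫ σ in s..t, ‖A σ‖| ^ (m + 1) / (m + 1).factorial) := by
  have hk := locallyIntegrable_norm hA
  have ch := continuous_primitive_of_locallyIntegrable hk s
  refine (norm_integral_le_abs_of_norm_le (g := fun τ => C / m.factorial *
    (‖A τ‖ * |∫ σ in s..τ, ‖A σ‖| ^ m)) ?_ ?_).trans ?_
  · refine (ae_restrict_iff' measurableSet_uIoc).2 (Filter.Eventually.of_forall fun τ hτ =>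
      (norm_mul_le _ _).trans ?_)
    calc _ ≤ ‖A τ‖ * (C * (|∫ σ in s..τ, ‖A σ‖| ^ m / m.factorial)) :=
          mul_le_mul_of_nonneg_left (hy τ (uIoc_subset_uIcc hτ)) (norm_nonneg _)
      _ = _ := by ring
  · exact (intervalIntegrable_of_locallyIntegrable
      (locallyIntegrable_mul_continuous hk (ch.abs.pow m)) s t).const_mul _
  · rw [intervalIntegral.integral_const_mul, abs_mul,
      abs_integral_mul_abs_pow hk (fun _ => norm_nonneg _),
      abs_of_nonneg (by positivity : 0 ≤ C / m.factorial), Nat.factorial_succ]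
    push_cast
    exact le_of_eq (by field_simp)

/-- Iterating the Picard bound, starting from the maximum of `‖y‖` on the interval, leaves
factorially small bounds. -/
theorem eq_zero_of_eq_integral_mul (hA : LocallyIntegrable A volume) {y : ℝ → 𝔸}
    (hy : Continuous y) {s : ℝ} (h : ∀ t, y t = ∫ τ in s..t, A τ * y τ) (t : ℝ) : y t = 0 := by
  obtain ⟨C, hC⟩ := isCompact_uIcc.exists_bound_of_continuousOn (hy.continuousOn (s := uIcc s t))
  have hC0 : 0 ≤ C := (norm_nonneg _).trans (hC s left_mem_uIcc)
  have key : ∀ m : ℕ, ∀ τ ∈ uIcc s t, ‖y τ‖ ≤ C * (|∫ σ in s..τ, ‖A σ‖| ^ m / m.factorial) := by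
    intro m
    induction m with
    | zero => simpa using hC
    | succ m ih =>
      intro τ hτ
      rw [h τ]
      exact norm_integral_mul_le hA hC0 fun σ hσ => ih σ (uIcc_subset_uIcc left_mem_uIcc hτ hσ)
  have lim := (FloorSemiring.tendsto_pow_div_factorial_atTop |∫ σ in s..t, ‖A σ‖|).const_mul C
  rw [mul_zero] at lim
  exact norm_le_zero_iff.1 (ge_of_tendsto' lim fun m => key m t right_mem_uIcc)

/-- Successive terms of the Dyson series. -/
noncomputable def dysonTerm (A : ℝ → 𝔸) (s : ℝ) : ℕ → ℝ → 𝔸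
  | 0, _ => 1
  | m + 1, t => ∫ τ in s..t, A τ * dysonTerm A s m τ

theorem continuous_dysonTerm (hA : LocallyIntegrable A volume) (s : ℝ) (m : ℕ) :
    Continuous (dysonTerm A s m) := by
  induction m with
  | zero => exact continuous_const
  | succ m ih =>
    exact continuous_primitive_of_locallyIntegrable (locallyIntegrable_mul_continuous hA ih) s

theorem norm_dysonTerm_le (hA : LocallyIntegrable A volume) (s t : ℝ) (m : ℕ) :
    ‖dysonTerm A s m t‖ ≤ ‖(1 : 𝔸)‖ * (|∫ σ in s..t, ‖A σ‖| ^ m / m.factorial) := by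
  induction m generalizing t with
  | zero => simp [dysonTerm]
  | succ m ih => exact norm_integral_mul_le hA (norm_nonneg _) fun τ _ => ih τ

theorem exists_eq_one_add_integral_mul [CompleteSpace 𝔸] (hA : LocallyIntegrable A volume)
    (s : ℝ) : ∃ y : ℝ → 𝔸, Continuous y ∧ ∀ t, y t = 1 + ∫ τ in s..t, A τ * y τ := by
  have hk := locallyIntegrable_norm hA
  have ch := continuous_primitive_of_locallyIntegrable hk s
  have hsum : ∀ x : ℝ, Summable fun m : ℕ => ‖(1 : 𝔸)‖ * (x ^ m / m.factorial) :=
    fun x => (Real.summable_pow_div_factorial x).mul_left _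
  have hds : ∀ t, Summable fun m => dysonTerm A s m t := fun t =>
    Summable.of_norm_bounded (hsum _) (norm_dysonTerm_le hA s t)
  refine ⟨fun t => ∑' m, dysonTerm A s m t, ?_, fun t => ?_⟩
  · refine continuous_iff_continuousAt.2 fun t => ?_
    obtain ⟨M, hM⟩ := isCompact_Icc.exists_bound_of_continuousOn
      (ch.continuousOn (s := Icc (t - 1) (t + 1)))
    refine (continuousOn_tsum (fun m => (continuous_dysonTerm hA s m).continuousOn) (hsum M)
      fun m τ hτ => (norm_dysonTerm_le hA s τ m).trans ?_).continuousAt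
        (Icc_mem_nhds (sub_one_lt t) (lt_add_one t))
    have := hM τ hτ
    rw [Real.norm_eq_abs] at this
    gcongr
  -- Termwise integration: the majorants sum to `‖A τ‖` times a continuous exponential, which is
  -- integrable.
  · have hI : HasSum (fun m => ∫ τ in s..t, A τ * dysonTerm A s m τ)
        (∫ τ in s..t, A τ * ∑' m, dysonTerm A s m τ) := by
      refine hasSum_integral_of_dominated_convergence
        (fun m τ => ‖A τ‖ * (‖(1 : 𝔸)‖ * (|∫ σ in s..τ, ‖A σ‖| ^ m / m.factorial)))
        (fun m => (locallyIntegrable_mul_continuous hA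
          (continuous_dysonTerm hA s m)).aestronglyMeasurable.restrict)
        (fun m => Filter.Eventually.of_forall fun τ _ => (norm_mul_le _ _).trans
          (mul_le_mul_of_nonneg_left (norm_dysonTerm_le hA s τ m) (norm_nonneg _)))
        (Filter.Eventually.of_forall fun τ _ => (hsum _).mul_left _) ?_
        (Filter.Eventually.of_forall fun τ _ => (hds τ).hasSum.mul_left _)
      simp only [tsum_mul_left]
      refine intervalIntegrable_of_locallyIntegrable (locallyIntegrable_mul_continuous hk
        (continuous_const.mul ?_)) s t
      have e : (fun τ => ∑' m : ℕ, |∫ σ in s..τ, ‖A σ‖| ^ m / m.factorial) =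
          fun τ => Real.exp |∫ σ in s..τ, ‖A σ‖| := by
        ext τ
        rw [Real.exp_eq_exp_ℝ, NormedSpace.exp_eq_tsum_div]
      rw [e]
      exact Real.continuous_exp.comp ch.abs
    rw [← hI.tsum_eq]
    exact (hds t).tsum_eq_zero_add

end Volterra
end Floquet

namespace Floquet

open Set intervalIntegral

/-! ### Propagators: uniqueness, composition and symmetries. -/

section Evolution

variable {𝔸 : Type*} [NormedRing 𝔸] [NormedAlgebra ℝ 𝔸] {A : ℝ → 𝔸}

theorem eq_of_eq_add_integral_mul (hA : LocallyIntegrable A volume) {y z : ℝ → 𝔸}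
    (cy : Continuous y) (cz : Continuous z) {s : ℝ} {c : 𝔸}
    (hy : ∀ t, y t = c + ∫ τ in s..t, A τ * y τ)
    (hz : ∀ t, z t = c + ∫ τ in s..t, A τ * z τ) (t : ℝ) : y t = z t := by
  have hi := fun t {x : ℝ → 𝔸} (cx : Continuous x) =>
    intervalIntegrable_of_locallyIntegrable (locallyIntegrable_mul_continuous hA cx) s t
  refine sub_eq_zero.1 (eq_zero_of_eq_integral_mul hA (cy.sub cz) (s := s) (fun t => ?_) t)
  simp only [Pi.sub_apply, mul_sub]
  rw [integral_sub (hi t cy) (hi t cz), hy t, hz t, add_sub_add_left_eq_sub]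

/-- `U s` is the solution of `y' = A y`, `y s = 1` in integrated form. -/
structure IsPropagator (A : ℝ → 𝔸) (U : ℝ → ℝ → 𝔸) : Prop where
  continuous : ∀ s, Continuous (U s)
  eq_one_add_integral : ∀ s t, U s t = 1 + ∫ τ in s..t, A τ * U s τ

theorem exists_isPropagator [CompleteSpace 𝔸] (hA : LocallyIntegrable A volume) :
    ∃ U, IsPropagator A U := by
  choose U h₁ h₂ using exists_eq_one_add_integral_mul hA
  exact ⟨U, h₁, h₂⟩

theorem IsPropagator.unique {U V : ℝ → ℝ → 𝔸} (hA : LocallyIntegrable A volume)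
    (hU : IsPropagator A U) (hV : IsPropagator A V) : U = V :=
  funext fun s => funext <| eq_of_eq_add_integral_mul hA (hU.continuous s) (hV.continuous s)
    (hU.eq_one_add_integral s) (hV.eq_one_add_integral s)

theorem IsPropagator.self {U : ℝ → ℝ → 𝔸} (hU : IsPropagator A U) (s : ℝ) : U s s = 1 := by
  rw [hU.eq_one_add_integral, integral_same, add_zero]

/-- As functions of `t`, both sides solve the equation with value `U s r` at time `r`. -/
theorem IsPropagator.mul_eq [CompleteSpace 𝔸] {U : ℝ → ℝ → 𝔸} (hA : LocallyIntegrable A volume)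
    (hU : IsPropagator A U) (r s t : ℝ) : U r t * U s r = U s t := by
  have hi := fun s a b => intervalIntegrable_of_locallyIntegrable
    (locallyIntegrable_mul_continuous hA (hU.continuous s)) a b
  refine eq_of_eq_add_integral_mul hA (y := fun t => U r t * U s r) (s := r) (c := U s r)
    ((hU.continuous r).mul continuous_const) (hU.continuous s) (fun t => ?_) (fun t => ?_) t
  · have := ((ContinuousLinearMap.mul ℝ 𝔸).flip (U s r)).intervalIntegral_comp_comm (hi r r t)
    simp only [ContinuousLinearMap.flip_apply, ContinuousLinearMap.mul_apply'] at this
    simp only [← mul_assoc]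
    rw [this, hU.eq_one_add_integral r t, add_mul, one_mul]
  · rw [hU.eq_one_add_integral s t, hU.eq_one_add_integral s r, add_assoc,
      integral_add_adjacent_intervals (hi s s r) (hi s r t)]

theorem IsPropagator.mul_symm [CompleteSpace 𝔸] {U : ℝ → ℝ → 𝔸} (hA : LocallyIntegrable A volume)
    (hU : IsPropagator A U) (s t : ℝ) : U t s * U s t = 1 := by
  rw [hU.mul_eq hA, hU.self]

theorem IsPropagator.add_period {U : ℝ → ℝ → 𝔸} (hA : LocallyIntegrable A volume)
    (hU : IsPropagator A U) {T : ℝ} (hT : Function.Periodic A T) (s t : ℝ) :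
    U (s + T) (t + T) = U s t := by
  have h : IsPropagator A fun s t => U (s + T) (t + T) := by
    refine ⟨fun s => (hU.continuous _).comp (continuous_add_const T), fun s t => ?_⟩
    rw [hU.eq_one_add_integral,
      ← integral_comp_add_right (fun τ => A τ * U (s + T) τ) T]
    simp only [hT _]
  exact congrFun₂ (h.unique hA hU) s t

/-- The sign from substituting -τ for τ cancels the sign in the chirality relation, so the left side
is again a propagator. -/
theorem IsPropagator.conj_neg [CompleteSpace 𝔸] {U : ℝ → ℝ → 𝔸} (hA : LocallyIntegrable A volume)
    (hU : IsPropagator A U) {Γ : 𝔸} (hΓ : Γ * Γ = 1) (h : ∀ t, Γ * A t * Γ = -A (-t)) (s t : ℝ) :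
    Γ * U (-s) (-t) * Γ = U s t := by
  have h' : IsPropagator A fun s t => Γ * U (-s) (-t) * Γ := by
    refine ⟨fun s => (continuous_const.mul ((hU.continuous _).comp continuous_neg)).mul
      continuous_const, fun s t => ?_⟩
    have hi := intervalIntegrable_of_locallyIntegrable
      (locallyIntegrable_mul_continuous hA (hU.continuous (-s))) (-s) (-t)
    have := (((ContinuousLinearMap.mul ℝ 𝔸).flip Γ).comp
      (ContinuousLinearMap.mul ℝ 𝔸 Γ)).intervalIntegral_comp_comm hi
    simp only [ContinuousLinearMap.comp_apply, ContinuousLinearMap.flip_apply,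
      ContinuousLinearMap.mul_apply'] at this
    rw [hU.eq_one_add_integral, mul_add, add_mul, mul_one, hΓ, ← this, integral_symm,
      ← integral_comp_neg (fun τ => Γ * (A τ * U (-s) τ) * Γ), ← intervalIntegral.integral_neg]
    congr 1
    refine integral_congr fun τ _ => ?_
    have e := h (-τ)
    rw [neg_neg] at e
    calc -(Γ * (A (-τ) * U (-s) (-τ)) * Γ)
        = -((Γ * A (-τ)) * (Γ * Γ) * U (-s) (-τ) * Γ) := by rw [hΓ]; noncomm_ring
      _ = -((Γ * A (-τ) * Γ) * (Γ * U (-s) (-τ) * Γ)) := by noncomm_ring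
      _ = _ := by rw [e]; noncomm_ring
  exact congrFun₂ (h'.unique hA hU) s t

end Evolution

/-! ### Matrix-valued equations and unitarity. -/

section Matrix

open scoped Matrix.Norms.L2Operator

variable {n : Type*} [Fintype n] [DecidableEq n]

theorem integral_matrix_apply {F : ℝ → Matrix n n ℂ} {s t : ℝ}
    (hF : IntervalIntegrable F volume s t) (i j : n) :
    (∫ τ in s..t, F τ) i j = ∫ τ in s..t, F τ i j :=
  ((Matrix.entryLinearMap ℝ ℂ i j).toContinuousLinearMap.intervalIntegral_comp_comm hF).symm

theorem locallyIntegrable_matrix_apply {F : ℝ → Matrix n n ℂ} (hF : LocallyIntegrable F volume)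
    (i j : n) : LocallyIntegrable (fun τ => F τ i j) volume :=
  fun x => by
    obtain ⟨s, hs, h⟩ := hF x
    exact ⟨s, hs, (Matrix.entryLinearMap ℝ ℂ i j).toContinuousLinearMap.integrable_comp h⟩

theorem locallyIntegrable_matrix {F : ℝ → Matrix n n ℂ}
    (hF : ∀ i j, LocallyIntegrable (fun τ => F τ i j) volume) : LocallyIntegrable F volume := by
  have e : F = fun τ => ∑ i, ∑ j, F τ i j • Matrix.single i j (1 : ℂ) := by
    ext τ
    conv_lhs => rw [Matrix.matrix_eq_sum_single (F τ)]
    simp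
  rw [e]
  exact locallyIntegrable_finsetSum _ fun i _ => locallyIntegrable_finsetSum _ fun j _ x => by
    obtain ⟨s, hs, h⟩ := hF i j x
    exact ⟨s, hs, h.smul_const _⟩

theorem isTimeEvolution_iff {H : ℝ → Matrix n n ℂ} (hH : LocallyIntegrable H volume)
    {U : ℝ → ℝ → Matrix n n ℂ} :
    IsTimeEvolution H U ↔ IsPropagator (fun t => (-Complex.I) • H t) U := by
  have key : ∀ s, Continuous (U s) → ∀ t i j,
      (1 + ∫ τ in s..t, ((-Complex.I) • H τ) * U s τ) i j =
        (1 : Matrix n n ℂ) i j - Complex.I * ∫ τ in s..t, (H τ * U s τ) i j := by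
    intro s hs t i j
    have hi := intervalIntegrable_of_locallyIntegrable (locallyIntegrable_mul_continuous hH hs) s t
    simp only [Matrix.smul_mul]
    rw [intervalIntegral.integral_smul, Matrix.add_apply, Matrix.smul_apply,
      integral_matrix_apply hi, smul_eq_mul]
    ring
  constructor
  · intro h
    exact ⟨h.continuous, fun s t => by
      ext i j
      rw [key s (h.continuous s), h.schrodinger]⟩
  · intro h
    exact ⟨h.continuous, fun s t i j => by
      rw [← key s (h.continuous s), ← h.eq_one_add_integral]⟩

theorem matrix_mul_eq_of_primitive {f g F G : ℝ → Matrix n n ℂ} {s : ℝ}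
    (hf : LocallyIntegrable f volume) (hg : LocallyIntegrable g volume)
    (hF : ∀ t, F t = F s + ∫ τ in s..t, f τ) (hG : ∀ t, G t = G s + ∫ τ in s..t, g τ)
    (h0 : ∀ τ, f τ * G τ + F τ * g τ = 0) (t : ℝ) : F t * G t = F s * G s := by
  have hF' : ∀ i j t, F t i j = F s i j + ∫ τ in s..t, f τ i j := fun i j t => by
    rw [hF t, Matrix.add_apply,
      integral_matrix_apply (intervalIntegrable_of_locallyIntegrable hf _ _)]
  have hG' : ∀ i j t, G t i j = G s i j + ∫ τ in s..t, g τ i j := fun i j t => by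
    rw [hG t, Matrix.add_apply,
      integral_matrix_apply (intervalIntegrable_of_locallyIntegrable hg _ _)]
  have hf' := locallyIntegrable_matrix_apply hf
  have hg' := locallyIntegrable_matrix_apply hg
  have cF : ∀ i j, Continuous fun t => F t i j := fun i j => by
    rw [funext (hF' i j)]
    exact continuous_const.add (continuous_primitive_of_locallyIntegrable (hf' i j) s)
  have cG : ∀ i j, Continuous fun t => G t i j := fun i j => by
    rw [funext (hG' i j)]
    exact continuous_const.add (continuous_primitive_of_locallyIntegrable (hg' i j) s)
  ext i j
  simp only [Matrix.mul_apply]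
  rw [Finset.sum_congr rfl fun k _ => mul_eq_add_integral_of_primitive (hf' i k) (hg' k j)
    (hF' i k) (hG' k j) t, Finset.sum_add_distrib, ← intervalIntegral.integral_finsetSum]
  · have : ∀ τ, ∑ k, (f τ i k * G τ k j + F τ i k * g τ k j) = 0 := fun τ => by
      have := congrFun₂ (h0 τ) i j
      simpa only [Matrix.add_apply, Matrix.mul_apply, Matrix.zero_apply,
        ← Finset.sum_add_distrib] using this
    simp [this]
  · exact fun k _ => intervalIntegrable_of_locallyIntegrable
      ((locallyIntegrable_mul_continuous (hf' i k) (cG k j)).add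
        (locallyIntegrable_continuous_mul (cF i k) (hg' k j))) s t

theorem conjTranspose_integral {F : ℝ → Matrix n n ℂ} {s t : ℝ}
    (hF : IntervalIntegrable F volume s t) :
    (∫ τ in s..t, F τ).conjTranspose = ∫ τ in s..t, (F τ).conjTranspose :=
  ((Matrix.conjTransposeLinearEquiv n n ℝ ℂ).toLinearMap.toContinuousLinearMap
    |>.intervalIntegral_comp_comm hF).symm

/-- Formally (U†U)' = U†(A† + A)U = 0; the integrated product rule makes this rigorous. -/
theorem IsPropagator.conjTranspose_mul_self {A : ℝ → Matrix n n ℂ} {U : ℝ → ℝ → Matrix n n ℂ}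
    (hA : LocallyIntegrable A volume) (hU : IsPropagator A U)
    (skew : ∀ t, (A t).conjTranspose = -A t) (s t : ℝ) :
    (U s t).conjTranspose * U s t = 1 := by
  have hg := locallyIntegrable_mul_continuous hA (hU.continuous s)
  have := matrix_mul_eq_of_primitive (f := fun τ => (A τ * U s τ).conjTranspose)
    (g := fun τ => A τ * U s τ) (F := fun t => (U s t).conjTranspose) (G := U s) (s := s) ?_ hg
    ?_ ?_ ?_ t
  · simpa [hU.self] using this
  · refine locallyIntegrable_matrix fun i j x => ?_
    obtain ⟨v, hv, h⟩ := locallyIntegrable_matrix_apply hg j i x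
    exact ⟨v, hv, Complex.conjCLE.toContinuousLinearMap.integrable_comp h⟩
  · intro t
    rw [← conjTranspose_integral (intervalIntegrable_of_locallyIntegrable hg s t),
      ← Matrix.conjTranspose_add, hU.self, ← hU.eq_one_add_integral]
  · intro t
    rw [hU.self, ← hU.eq_one_add_integral]
  · intro τ
    rw [Matrix.conjTranspose_mul, skew, Matrix.mul_neg, Matrix.neg_mul, Matrix.mul_assoc,
      neg_add_cancel]

end Matrix
end Floquet

/-! ### Signature and trace of Hermitian involutions. -/

namespace Floquet

variable {n : Type*} [Fintype n] [DecidableEq n]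

/-- A Hermitian involution has signature equal to its trace. -/
theorem sig_eq_trace {X : Matrix n n ℂ} (hX : X.IsHermitian) (h : X * X = 1) :
    (sig hX : ℂ) = X.trace := by
  have hsq : ∀ i, hX.eigenvalues i = 1 ∨ hX.eigenvalues i = -1 := by
    intro i
    have h1 := hX.mulVec_eigenvectorBasis i
    have hv : (hX.eigenvectorBasis i).ofLp ≠ 0 := by
      intro h0
      exact (hX.eigenvectorBasis.orthonormal.ne_zero i) (by ext j; exact congrFun h0 j)
    have h2 : X.mulVec (X.mulVec (hX.eigenvectorBasis i).ofLp) =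
        (hX.eigenvectorBasis i).ofLp := by
      rw [Matrix.mulVec_mulVec, h, Matrix.one_mulVec]
    rw [h1, Matrix.mulVec_smul, h1, smul_smul] at h2
    have h3 : (hX.eigenvalues i * hX.eigenvalues i - 1) • (hX.eigenvectorBasis i).ofLp = 0 := by
      rw [sub_smul, h2, one_smul, sub_self]
    rcases smul_eq_zero.1 h3 with h4 | h4
    · exact mul_self_eq_one_iff.1 (sub_eq_zero.1 h4)
    · exact absurd h4 hv
  rw [hX.trace_eq_sum_eigenvalues, sig, Finset.card_filter, Finset.card_filter]
  push_cast
  rw [← Finset.sum_sub_distrib]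
  refine Finset.sum_congr rfl fun i _ => ?_
  rcases hsq i with h | h <;> rw [h] <;> norm_num

/-- The matrices (1 ± Γ)/2 project onto the two eigenspaces, so their traces are the two equal
dimensions. -/
theorem IsBalancedGrading.trace_eq_zero {Γ : Matrix n n ℂ} (hΓ : IsBalancedGrading Γ) :
    Γ.trace = 0 := by
  have key : ∀ (ε : ℂ), ε * ε = 1 → LinearMap.IsProj
      (Module.End.eigenspace (Matrix.toLin' Γ) ε) (Matrix.toLin' ((1 / 2 : ℂ) • (1 + ε • Γ))) := by
    intro ε hε
    refine ⟨fun x => ?_, fun x hx => ?_⟩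
    · rw [Module.End.mem_eigenspace_iff]
      simp only [← Matrix.toLin'_mul_apply, Matrix.mul_smul, Matrix.mul_add, mul_one, hΓ.sq_eq_one]
      rw [← LinearMap.smul_apply, ← map_smul]
      congr 2
      simp only [smul_add, smul_smul]
      rw [show ε * (1 / 2 * ε) = 1 / 2 by linear_combination hε / 2, mul_comm ε, add_comm]
    · rw [Module.End.mem_eigenspace_iff] at hx
      simp only [map_smul, map_add, LinearMap.smul_apply, LinearMap.add_apply, hx, smul_smul, hε,
        Matrix.toLin'_one, LinearMap.id_apply]
      module
  have h1 := (key 1 (by norm_num)).trace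
  have h2 := (key (-1) (by norm_num)).trace
  rw [Matrix.trace_toLin'_eq] at h1 h2
  rw [hΓ.balanced, ← h2] at h1
  simp only [Matrix.trace_smul, Matrix.trace_add, smul_eq_mul] at h1
  linear_combination h1

theorem IsBalancedGrading.conjTranspose_eq {Γ : Matrix n n ℂ} (hΓ : IsBalancedGrading Γ) :
    Γ.conjTranspose = Γ := by
  have h : Γ.conjTranspose * Γ = 1 := Matrix.mem_unitaryGroup_iff'.1 hΓ.unitary
  calc Γ.conjTranspose = Γ.conjTranspose * (Γ * Γ) := by rw [hΓ.sq_eq_one, mul_one]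
    _ = Γ := by rw [← mul_assoc, h, one_mul]

/-- A unitary conjugate of a balanced grading is Hermitian and invertible of signature zero. -/
theorem IsBalancedGrading.sig_conj_eq_zero {Γ B X : Matrix n n ℂ} (hΓ : IsBalancedGrading Γ)
    (hB : B ∈ Matrix.unitaryGroup n ℂ) (hX : X = B.conjTranspose * Γ * B) :
    ∃ h : X.IsHermitian, IsUnit X ∧ (1 / 2 : ℚ) * (sig h : ℚ) = 0 := by
  have hB' : B * B.conjTranspose = 1 := Matrix.mem_unitaryGroup_iff.1 hB
  have hB'' : B.conjTranspose * B = 1 := Matrix.mem_unitaryGroup_iff'.1 hB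
  have herm : X.IsHermitian := by
    rw [hX]
    exact Matrix.isHermitian_conjTranspose_mul_mul B hΓ.conjTranspose_eq
  have sq : X * X = 1 := by
    calc X * X = B.conjTranspose * Γ * (B * B.conjTranspose) * Γ * B := by
          rw [hX]; simp only [mul_assoc]
      _ = B.conjTranspose * (Γ * Γ) * B := by rw [hB']; simp only [mul_assoc, one_mul]
      _ = 1 := by rw [hΓ.sq_eq_one, mul_one, hB'']
  have tr : (sig herm : ℂ) = 0 := by
    rw [sig_eq_trace herm sq, hX, Matrix.trace_mul_comm, ← mul_assoc, hB', one_mul,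
      hΓ.trace_eq_zero]
  exact ⟨herm, IsUnit.of_mul_eq_one X sq, by rw [Int.cast_eq_zero.1 tr]; simp⟩

end Floquet

/-! ### The chiral factorization and the theorem. -/

namespace Floquet

open scoped Matrix.Norms.L2Operator

variable {n : Type*} [Fintype n] [DecidableEq n]

/-- For a chiral periodic generator, the evolution from `t` to `T - t` factors through the
half-period: its chiral part is the adjoint of the evolution from `t` to `T / 2`. -/
theorem IsPropagator.eq_chiral_factorization {A : ℝ → Matrix n n ℂ} {U : ℝ → ℝ → Matrix n n ℂ}
    (hA : LocallyIntegrable A volume) (hU : IsPropagator A U)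
    (skew : ∀ t, (A t).conjTranspose = -A t) {T : ℝ} (hT : Function.Periodic A T)
    {Γ : Matrix n n ℂ} (hΓ : Γ * Γ = 1) (chiral : ∀ t, Γ * A t * Γ = -A (-t)) (t : ℝ) :
    U t (T - t) = Γ * (U t (T / 2)).conjTranspose * Γ * U t (T / 2) := by
  set V := Γ * U t (T / 2) * Γ with hV
  -- Chirality reflects both times through 0; a shift by `T` then sends `-t` to `T - t` and fixes
  -- the endpoint `T / 2`.
  have hV' : V = U (T - t) (T / 2) := by
    have h := hU.conj_neg hA hΓ chiral (-t) (-(T / 2))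
    rw [neg_neg, neg_neg] at h
    rw [hV, h, ← hU.add_period hA hT]
    congr 1 <;> ring
  have h₁ : Γ * (U t (T / 2)).conjTranspose * Γ * V = 1 := by
    calc _ = Γ * ((U t (T / 2)).conjTranspose * (Γ * Γ) * U t (T / 2)) * Γ := by
          rw [hV]; simp only [mul_assoc]
      _ = 1 := by rw [hΓ, mul_one, hU.conjTranspose_mul_self hA skew, mul_one, hΓ]
  have h₂ : V * U (T / 2) (T - t) = 1 := by rw [hV', hU.mul_symm hA]
  -- A left and a right inverse of `V` agree, which identifies `U (T / 2) (T - t)`.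
  rw [← hU.mul_eq hA (T / 2), ← left_inv_eq_right_inv h₁ h₂]

variable {H : ℝ → Matrix n n ℂ} {U : ℝ → ℝ → Matrix n n ℂ} {T : ℝ}

theorem IsPeriodicHamiltonian.locallyIntegrable_generator (hH : IsPeriodicHamiltonian H T) :
    LocallyIntegrable (fun t => (-Complex.I) • H t) volume :=
  (locallyIntegrable_matrix hH.locallyIntegrable).smul (-Complex.I)

theorem IsPeriodicHamiltonian.conjTranspose_generator {m : Type*} {H : ℝ → Matrix m m ℂ} {T : ℝ}
    (hH : IsPeriodicHamiltonian H T) (t : ℝ) :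
    ((-Complex.I) • H t).conjTranspose = -((-Complex.I) • H t) := by
  rw [Matrix.conjTranspose_smul, (hH.isHermitian t).eq]
  simp

theorem IsPeriodicHamiltonian.isPropagator (hH : IsPeriodicHamiltonian H T)
    (hU : IsTimeEvolution H U) : IsPropagator (fun t => (-Complex.I) • H t) U :=
  (isTimeEvolution_iff (locallyIntegrable_matrix hH.locallyIntegrable)).1 hU

theorem IsPeriodicHamiltonian.existsUnique_isTimeEvolution (hH : IsPeriodicHamiltonian H T) :
    ∃! U : ℝ → ℝ → Matrix n n ℂ, IsTimeEvolution H U := by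
  obtain ⟨U, hU⟩ := exists_isPropagator hH.locallyIntegrable_generator
  exact ⟨U, (isTimeEvolution_iff (locallyIntegrable_matrix hH.locallyIntegrable)).2 hU,
    fun V hV => (hH.isPropagator hV).unique hH.locallyIntegrable_generator hU⟩

theorem IsPeriodicHamiltonian.evolution_self (hH : IsPeriodicHamiltonian H T)
    (hU : IsTimeEvolution H U) (s : ℝ) : U s s = 1 :=
  (hH.isPropagator hU).self s

theorem IsPeriodicHamiltonian.evolution_mem_unitaryGroup (hH : IsPeriodicHamiltonian H T)
    (hU : IsTimeEvolution H U) (s t : ℝ) : U s t ∈ Matrix.unitaryGroup n ℂ :=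
  Matrix.mem_unitaryGroup_iff'.2 ((hH.isPropagator hU).conjTranspose_mul_self
    hH.locallyIntegrable_generator hH.conjTranspose_generator s t)

/-- Continuity is only given in the final time; a fixed base time `r` yields continuity in both
variables. -/
theorem IsPeriodicHamiltonian.evolution_eq_mul_conjTranspose (hH : IsPeriodicHamiltonian H T)
    (hU : IsTimeEvolution H U) (r s t : ℝ) : U s t = U r t * (U r s).conjTranspose := by
  have hP := hH.isPropagator hU
  rw [← hP.mul_eq hH.locallyIntegrable_generator r s t,
    left_inv_eq_right_inv (b := (U r s).conjTranspose)
      (Matrix.mem_unitaryGroup_iff'.1 (hH.evolution_mem_unitaryGroup hU r s))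
      (hP.mul_symm hH.locallyIntegrable_generator s r)]

theorem IsPeriodicHamiltonian.evolution_chiral (hH : IsPeriodicHamiltonian H T)
    (hU : IsTimeEvolution H U) {Γ : Matrix n n ℂ} (hΓ : Γ * Γ = 1)
    (chiral : ∀ t, Γ * H t * Γ = -H (-t)) (t : ℝ) :
    U t (T - t) = Γ * (U t (T / 2)).conjTranspose * Γ * U t (T / 2) :=
  (hH.isPropagator hU).eq_chiral_factorization hH.locallyIntegrable_generator
    hH.conjTranspose_generator (fun t => by simp only [hH.periodic t]) hΓ
    (fun t => by rw [Matrix.mul_smul, Matrix.smul_mul, chiral, smul_neg]) t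

end Floquet

theorem mainTheorem8 {n : Type*} [Fintype n] [DecidableEq n]
    (T : ℝ) (H : ℝ → Matrix n n ℂ) (hH : Floquet.IsPeriodicHamiltonian H T)
    (Γ : Matrix n n ℂ) (hΓ : Floquet.IsBalancedGrading Γ)
    (chiral : ∀ t, Γ * H t * Γ = -H (-t)) :
    (∃! U : ℝ → ℝ → Matrix n n ℂ, Floquet.IsTimeEvolution H U) ∧
    ∀ U : ℝ → ℝ → Matrix n n ℂ, Floquet.IsTimeEvolution H U →
      (∃ hX : (U 0 T * Γ).IsHermitian,
        IsUnit (U 0 T * Γ) ∧ (1 / 2 : ℚ) * (Floquet.sig hX : ℚ) = 0) ∧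
      ContinuousOn (fun t => U t (T - t)) (Set.Icc 0 (T / 2)) ∧
      U (T / 2) (T - T / 2) = 1 ∧
      ∀ t ∈ Set.Icc 0 (T / 2),
        U t (T - t) ∈ Matrix.unitaryGroup n ℂ ∧
        Γ * U t (T - t) * Γ = (U t (T - t)).conjTranspose ∧
        ∃ hX : (U t (T - t) * Γ).IsHermitian,
          IsUnit (U t (T - t) * Γ) ∧ (1 / 2 : ℚ) * (Floquet.sig hX : ℚ) = 0 := by
  refine ⟨hH.existsUnique_isTimeEvolution, fun U hU => ?_⟩
  have hmem := hH.evolution_mem_unitaryGroup hU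
  have hfac := hH.evolution_chiral hU hΓ.sq_eq_one chiral
  have hsig : ∀ t, ∃ hX : (U t (T - t) * Γ).IsHermitian,
      IsUnit (U t (T - t) * Γ) ∧ (1 / 2 : ℚ) * (Floquet.sig hX : ℚ) = 0 := fun t => by
    refine hΓ.sig_conj_eq_zero (B := U t (T / 2) * Γ) (mul_mem (hmem _ _) hΓ.unitary) ?_
    rw [hfac, Matrix.conjTranspose_mul, hΓ.conjTranspose_eq]
    simp only [mul_assoc]
  refine ⟨by simpa only [sub_zero] using hsig 0, ?_, ?_, fun t _ => ⟨hmem _ _, ?_, hsig t⟩⟩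
  · rw [funext fun t => hH.evolution_eq_mul_conjTranspose hU 0 t (T - t)]
    exact (((hU.continuous 0).comp (continuous_const.sub continuous_id)).matrix_mul
      (hU.continuous 0).matrix_conjTranspose).continuousOn
  · rw [sub_half, hH.evolution_self hU]
  · rw [hfac, Matrix.conjTranspose_mul, Matrix.conjTranspose_mul, Matrix.conjTranspose_mul,
      Matrix.conjTranspose_conjTranspose, hΓ.conjTranspose_eq]
    calc _ = (Γ * Γ) * (U t (T / 2)).conjTranspose * Γ * U t (T / 2) * Γ := by
          simp only [mul_assoc]
      _ = _ := by rw [hΓ.sq_eq_one, one_mul]; simp only [mul_assoc]
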